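/- Consider $[0,1)$ with Lebesgue measure. A filtration is a sequence $\mathcal A_1,\mathcal A_2,\dots$ of countable partitions of $[0,1)$ into Lebesgue measurable sets such that every $A\in\mathcal A_n$ is a union of some sets of $\mathcal A_{n+1}$. A martingale difference is a sequence of real functions $f_n\in L^1(0,1)$, $n\ge 1$, for which there is a filtration $\{\mathcal A_n\}$ such that $f_n$ is constant on each $A\in\mathcal A_n$, and $\int_A f_n=0$ for every $A\in\mathcal A_{n-1}$, $n\ge 2$. Let $\{f_n\}$ be a martingale difference and let $p_n=\sum_{j\in G_n}c_jf_j$, $n=1,2,\dots$, where the $G_n\subset\mathbb N$ are finite and pairwise disjoint, $c_j\in\mathbb R$, and $\|p_n\|_{L^2(0,1)}=1$ for all $n$. Let $\omega(1)\le\omega(2)\le\cdots$ be positive numbers such that $\omega(n)/\log_2 n$, $n\ge 2$, is nondecreasing and $$\sum_{n=1}^\infty\frac{1}{n\,\omega(n)}<\infty .$$ Then $\omega(n)$ is an a.e. unconditional convergence Weyl multiplier for $\{p_n\}$. That is: $\{p_n\}$ is an orthonormal system, $\omega(n)$ is positive and nondecreasing with $\omega(n)\to\infty$, and for all real numbers $a_n$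 with $\sum_{n=1}^\infty a_n^2\,\omega(n)<\infty$ and every permutation $\sigma$ of $\{1,2,\dots\}$ the series $\sum_{n=1}^\infty a_{\sigma(n)}p_{\sigma(n)}(x)$ converges for almost every $x\in[0,1)$. -/

import Mathlib

open MeasureTheory Filter Topology

namespace WeylMultipliers

/-! Sequences `x₁, x₂, …` are indexed by `ℕ`, the entry with index `n` being `xₙ₊₁`. -/

/-- Lebesgue measure on `[0,1)`. -/
noncomputable def unitMeasure : Measure ℝ := volume.restrict (Set.Ico (0 : ℝ) 1)

/-- A partition of `[0,1)` into (finitely or countably many, pairwise disjoint)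
Lebesgue measurable sets. -/
structure IsPartition (P : Set (Set ℝ)) : Prop where
  countable : P.Countable
  measurable : ∀ A ∈ P, NullMeasurableSet A volume
  disjoint : P.PairwiseDisjoint id
  sUnion_eq : ⋃₀ P = Set.Ico (0 : ℝ) 1

/-- A filtration: a sequence of partitions of `[0,1)` such that every element of a partition
is a union of some elements of the next one. -/
structure IsPartitionFiltration (𝒜 : ℕ → Set (Set ℝ)) : Prop where
  partition : ∀ n, IsPartition (𝒜 n)
  refine_succ : ∀ n, ∀ A ∈ 𝒜 n, ∃ S ⊆ 𝒜 (n + 1), A = ⋃₀ S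

/-- `f` is a martingale difference based on the filtration `𝒜`. -/
structure IsMartingaleDifferenceOn (𝒜 : ℕ → Set (Set ℝ)) (f : ℕ → ℝ → ℝ) : Prop where
  filtration : IsPartitionFiltration 𝒜
  integrable : ∀ n, Integrable (f n) unitMeasure
  constant_on : ∀ n, ∀ A ∈ 𝒜 n, ∃ c : ℝ, ∀ x ∈ A, f n x = c
  integral_eq_zero : ∀ n, ∀ A ∈ 𝒜 n, ∫ x in A, f (n + 1) x = 0

/-- `f` is a martingale difference, i.e. it is based on some filtration of `[0,1)`. -/
def IsMartingaleDifference (f : ℕ → ℝ → ℝ) : Prop :=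
  ∃ 𝒜 : ℕ → Set (Set ℝ), IsMartingaleDifferenceOn 𝒜 f

/-- `p` is a sequence of non-overlapping `f`-polynomials: `pₙ = ∑_{j ∈ Gₙ} cⱼ fⱼ` on `[0,1)`
with finite pairwise disjoint sets of indices `Gₙ`. -/
def IsNonOverlappingPolynomials (f p : ℕ → ℝ → ℝ) : Prop :=
  ∃ (G : ℕ → Finset ℕ) (c : ℕ → ℝ),
    (∀ m n, m ≠ n → Disjoint (G m) (G n)) ∧
    ∀ n, ∀ x ∈ Set.Ico (0 : ℝ) 1, p n x = ∑ j ∈ G n, c j * f j x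

/-- An orthonormal system in `L²(0,1)`. -/
structure IsOrthonormalSystem (φ : ℕ → ℝ → ℝ) : Prop where
  memLp : ∀ n, MemLp (φ n) 2 unitMeasure
  norm_eq_one : ∀ n, ∫ x, φ n x * φ n x ∂unitMeasure = 1
  orthogonal : ∀ m n, m ≠ n → ∫ x, φ m x * φ n x ∂unitMeasure = 0

/-- The series `∑ gₙ(x)` converges (to a finite limit) for a.e. `x ∈ [0,1)`. -/
def AEConvergent (g : ℕ → ℝ → ℝ) : Prop :=
  ∀ᵐ x ∂unitMeasure, ∃ l : ℝ,
    Tendsto (fun N : ℕ => ∑ n ∈ Finset.range N, g n x) atTop (𝓝 l)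

/-- The series `∑ gₙ(x)` converges unconditionally a.e.: every rearrangement of it converges
almost everywhere (the exceptional null set may depend on the rearrangement). -/
def AEUnconditionallyConvergent (g : ℕ → ℝ → ℝ) : Prop :=
  ∀ σ : Equiv.Perm ℕ, AEConvergent (fun n => g (σ n))

/-- `ω` is an a.e. unconditional convergence Weyl multiplier for the orthonormal system `φ`. -/
structure IsUCMultiplier (ω : ℕ → ℝ) (φ : ℕ → ℝ → ℝ) : Prop where
  orthonormal : IsOrthonormalSystem φ
  pos : ∀ n, 0 < ω n
  mono : Monotone ω
  tendsto : Tendsto ω atTop atTop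
  convergent : ∀ a : ℕ → ℝ, Summable (fun n => a n ^ 2 * ω n) →
    AEUnconditionallyConvergent (fun n x => a n * φ n x)

end WeylMultipliers

/-!
Let `X` be a square integrable martingale difference for a filtration `ℱ`. Since
`exp (x - x ^ 2) ≤ 1 + x + x ^ 2`, the exponential of the martingale minus its two brackets
`∑ X j ^ 2` and `∑ 𝔼[X j ^ 2 | ℱ (j - 1)]` is a supermartingale. Applying this to multiples of `X`,
Markov's inequality yields `|∑ X j| ≤ u / t + t * (sum of the brackets)`, over any finite set of
indices and for all `t > 0`, outside an event of probability `O(exp (-u))`.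

Split the series into the blocks `2 ^ 2 ^ k ≤ n < 2 ^ 2 ^ (k + 1)`. A rearrangement enumerates a
block in some order, so its partial sums only see fewer than `2 ^ 2 ^ (k + 1)` different nonempty
parts of the block. Hence, with `u = 3 * 2 ^ k` and `t = ω (2 ^ 2 ^ k)`, Borel–Cantelli makes the
above inequality hold simultaneously for all of these parts, for all large `k`. The bounds are
summable over `k`: the first terms because Cauchy condensation, used twice, turns
`∑ 1 / (n * ω n) < ∞` into `∑ 2 ^ k / ω (2 ^ 2 ^ k) < ∞`, the second ones because they have a finite
total expectation, at most `2 * ∑ a n ^ 2 * ω n` up to finitely many blocks.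
-/

namespace WeylMultipliers

lemma exp_sub_sq_le (x : ℝ) : Real.exp (x - x ^ 2) ≤ 1 + x + x ^ 2 := by
  have hpos : 0 < 1 - x + x ^ 2 := by nlinarith [sq_nonneg (x - 1 / 2)]
  have hexp : 1 - x + x ^ 2 ≤ Real.exp (-(x - x ^ 2)) := by
    linarith [Real.add_one_le_exp (-(x - x ^ 2))]
  calc Real.exp (x - x ^ 2) = (Real.exp (-(x - x ^ 2)))⁻¹ := by rw [Real.exp_neg, inv_inv]
    _ ≤ (1 - x + x ^ 2)⁻¹ := inv_anti₀ hpos hexp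
    _ ≤ 1 + x + x ^ 2 := by
      rw [inv_le_iff_one_le_mul₀ hpos]
      nlinarith [sq_nonneg x, sq_nonneg (x ^ 2)]

lemma exp_sub_sq_le_two (x : ℝ) : Real.exp (x - x ^ 2) ≤ 2 := by
  rw [← Real.le_log_iff_exp_le two_pos]
  nlinarith [sq_nonneg (x - 1 / 2), Real.log_two_gt_d9]

section Condensation

variable {g : ℕ → ℝ}

lemma summable_comp_two_pow (hg0 : ∀ n, 0 ≤ g n) (hg : Antitone g)
    (h : Summable fun n : ℕ => g n / (n + 1)) : Summable fun k : ℕ => g (2 ^ k) := by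
  rw [← summable_condensed_iff_of_nonneg fun n => div_nonneg (hg0 n) (by positivity)] at h
  · refine (h.mul_left 2).of_nonneg_of_le (fun k => hg0 _) fun k => ?_
    have hk : (1 : ℝ) ≤ 2 ^ k := one_le_pow₀ one_le_two
    push_cast
    rw [← mul_assoc, mul_div_assoc', le_div_iff₀ (by positivity)]
    nlinarith [hg0 (2 ^ k)]
  · intro m n _ hmn
    exact div_le_div₀ (hg0 m) (hg hmn) (by positivity) (by gcongr)

lemma summable_two_pow_mul_comp_two_pow_two_pow (hg0 : ∀ n, 0 ≤ g n) (hg : Antitone g)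
    (h : Summable fun n : ℕ => g n / (n + 1)) :
    Summable fun k : ℕ => 2 ^ k * g (2 ^ 2 ^ k) :=
  (summable_condensed_iff_of_nonneg (f := fun k => g (2 ^ k)) (fun _ => hg0 _)
    fun _ _ _ hmn => hg (Nat.pow_le_pow_right two_pos hmn)).2 (summable_comp_two_pow hg0 hg h)

end Condensation

section Weight

variable {ω : ℕ → ℝ}

lemma antitone_inv_of_monotone (hpos : ∀ n, 0 < ω n) (hmono : Monotone ω) :
    Antitone fun n => (ω n)⁻¹ :=
  fun m _ hmn => inv_anti₀ (hpos m) (hmono hmn)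

lemma tendsto_atTop_of_summable_inv_comp {φ : ℕ → ℕ} (hpos : ∀ n, 0 < ω n) (hmono : Monotone ω)
    (h : Summable fun k => (ω (φ k))⁻¹) : Tendsto ω atTop atTop := by
  refine tendsto_atTop_of_monotone_of_subseq (φ := φ) (l := atTop) hmono ?_
  have hpos' : ∀ᶠ k in atTop, 0 < (ω (φ k))⁻¹ := .of_forall fun k => inv_pos.2 (hpos _)
  exact (tendsto_nhdsWithin_iff.2 ⟨h.tendsto_atTop_zero, hpos'⟩).inv_tendsto_nhdsGT_zero.congr
    fun k => inv_inv _

end Weight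

section Fibers

variable {ι E : Type*} [NormedAddCommGroup E] {κ : ι → ℕ} {B : ℕ → Finset ι}
  {y : ι → E}

lemma sum_range_eq_tsum_sum_fiber (hB : ∀ k i, i ∈ B k ↔ κ i = k) (σ : ℕ ≃ ι) (M : ℕ) :
    ∑ n ∈ Finset.range M, y (σ n) = ∑' k, ∑ i ∈ B k with σ.symm i < M, y i := by
  classical
  set T := (Finset.range M).map σ.toEmbedding with hT
  have hfiber : ∀ k, {i ∈ B k | σ.symm i < M} = {i ∈ T | κ i = k} := fun k => by
    ext i
    simp only [hT, Finset.mem_filter, Finset.mem_map_equiv, Finset.mem_range, hB, and_comm]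
  simp only [hfiber]
  rw [tsum_eq_sum (s := T.image κ),
    Finset.sum_fiberwise_of_maps_to fun i hi => Finset.mem_image_of_mem κ hi, hT, Finset.sum_map]
  · rfl
  · intro k hk
    refine Finset.sum_eq_zero fun i hi => absurd ?_ hk
    obtain ⟨hiT, rfl⟩ := Finset.mem_filter.1 hi
    exact Finset.mem_image_of_mem κ hiT

variable [CompleteSpace E]

lemma summable_sum_fiber (hB : ∀ k i, i ∈ B k ↔ κ i = k) (hy : Summable y) :
    Summable fun k => ∑ i ∈ B k, y i := by
  refine ((Equiv.sigmaFiberEquiv κ).summable_iff.2 hy).sigma.congr fun k => ?_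
  have hfiber : {i | κ i = k} = ↑(B k) := Set.ext fun i => (hB k i).symm
  rw [← Finset.tsum_subtype', ← hfiber]
  rfl

lemma exists_tendsto_sum_of_fiber_bound (hB : ∀ k i, i ∈ B k ↔ κ i = k) (σ : ℕ ≃ ι) {δ : ℕ → ℝ}
    (hδ : Summable δ)
    (h : ∀ᶠ k in atTop, ∀ M, ‖∑ i ∈ B k with σ.symm i < M, y i‖ ≤ δ k) :
    ∃ l, Tendsto (fun M => ∑ n ∈ Finset.range M, y (σ n)) atTop (𝓝 l) := by
  obtain ⟨K, hK⟩ := eventually_atTop.1 h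
  let bound : ℕ → ℝ := fun k => if k < K then ∑ i ∈ B k, ‖y i‖ else δ k
  have hbound : Summable bound := hδ.congr_atTop <| by
    filter_upwards [eventually_ge_atTop K] with k hk
    simp only [bound, if_neg hk.not_gt]
  have hle : ∀ M k, ‖∑ i ∈ B k with σ.symm i < M, y i‖ ≤ bound k := fun M k => by
    by_cases hk : k < K
    · simp only [bound, if_pos hk]
      exact (norm_sum_le _ _).trans <| Finset.sum_le_sum_of_subset_of_nonneg
        (Finset.filter_subset _ _) fun _ _ _ => norm_nonneg _
    · simp only [bound, if_neg hk]
      exact hK k (not_lt.1 hk) M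
  have hlim : ∀ k, Tendsto (fun M => ∑ i ∈ B k with σ.symm i < M, y i) atTop
      (𝓝 (∑ i ∈ B k, y i)) := fun k => by
    refine tendsto_const_nhds.congr' ?_
    filter_upwards [eventually_gt_atTop ((B k).sup σ.symm)] with M hM
    rw [Finset.filter_true_of_mem fun i hi => (Finset.le_sup hi).trans_lt hM]
  simp only [sum_range_eq_tsum_sum_fiber hB σ]
  exact ⟨_, tendsto_tsum_of_dominated_convergence hbound hlim (.of_forall hle)⟩

end Fibers

/-- The dyadic logarithm of the dyadic logarithm, rounded down. The convergence proof splits a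
series into the blocks of indices on which it is constant; `0`, `1`, `2` and `3` all lie in the
block `0`. -/
def logLog (n : ℕ) : ℕ := Nat.log 2 (Nat.log 2 n)

/-- The block of all indices `n` with `logLog n = k`, as a finite set. -/
def logLogBlock (k : ℕ) : Finset ℕ := {n ∈ Finset.range (2 ^ 2 ^ (k + 1)) | logLog n = k}

lemma mem_logLogBlock (k n : ℕ) : n ∈ logLogBlock k ↔ logLog n = k := by
  simp only [logLogBlock, Finset.mem_filter, Finset.mem_range, and_iff_right_iff_imp]
  rintro rfl
  exact Nat.lt_pow_of_log_lt one_lt_two (Nat.lt_pow_succ_log_self one_lt_two _)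

lemma two_pow_two_pow_le_of_mem_logLogBlock {k n : ℕ} (hk : k ≠ 0) (hn : n ∈ logLogBlock k) :
    2 ^ 2 ^ k ≤ n := by
  obtain rfl := (mem_logLogBlock k n).1 hn
  have hlog : Nat.log 2 n ≠ 0 := fun h => hk (by rw [logLog, h, Nat.log_zero_right])
  have hn0 : n ≠ 0 := fun h => hlog (by rw [h, Nat.log_zero_right])
  exact (Nat.pow_le_pow_right two_pos (Nat.pow_log_le_self 2 hlog)).trans
    (Nat.pow_log_le_self 2 hn0)

lemma card_logLogBlock_le_exp (k : ℕ) : ((logLogBlock k).card : ℝ) ≤ Real.exp (2 * 2 ^ k) :=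
  calc ((logLogBlock k).card : ℝ) ≤ 2 ^ 2 ^ (k + 1) := by
        exact_mod_cast (Finset.card_filter_le _ _).trans (Finset.card_range _).le
    _ ≤ Real.exp 1 ^ 2 ^ (k + 1) :=
      pow_le_pow_left₀ zero_le_two (by linarith [Real.add_one_le_exp (1 : ℝ)]) _
    _ = Real.exp (2 * 2 ^ k) := by rw [← Real.exp_nat_mul]; push_cast; ring_nf

lemma summable_card_logLogBlock_mul_exp :
    Summable fun k => ((logLogBlock k).card : ℝ) * Real.exp (-(3 * 2 ^ k)) := by
  refine Real.summable_exp_neg_nat.of_nonneg_of_le (fun k => by positivity) fun k => ?_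
  have hk : (k : ℝ) ≤ 2 ^ k := by exact_mod_cast Nat.lt_two_pow_self.le
  calc ((logLogBlock k).card : ℝ) * Real.exp (-(3 * 2 ^ k))
      ≤ Real.exp (2 * 2 ^ k) * Real.exp (-(3 * 2 ^ k)) := by
        gcongr
        exact card_logLogBlock_le_exp k
    _ = Real.exp (-2 ^ k) := by rw [← Real.exp_add]; ring_nf
    _ ≤ Real.exp (-k) := by gcongr

section CondExp

variable {Ω : Type*} {m m₀ : MeasurableSpace Ω} {μ : Measure Ω} {X Y : Ω → ℝ}

lemma ae_exp_sub_sq_add_condExp_le :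
    ∀ᵐ ω ∂μ, Real.exp (X ω - (X ω ^ 2 + μ[fun ω' => X ω' ^ 2 | m] ω)) ≤ 2 := by
  filter_upwards [condExp_nonneg (m := m) (.of_forall fun ω => sq_nonneg (X ω))] with ω hω
  refine (Real.exp_le_exp.2 ?_).trans (exp_sub_sq_le_two (X ω))
  linarith [show 0 ≤ μ[fun ω' => X ω' ^ 2 | m] ω from hω]

variable [IsFiniteMeasure μ]

lemma integral_mul_eq_zero_of_condExp_ae_eq_zero (hm : m ≤ m₀) (hY : StronglyMeasurable[m] Y)
    (hX : Integrable X μ) (hYX : Integrable (Y * X) μ) (h : μ[X | m] =ᵐ[μ] 0) :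
    ∫ ω, Y ω * X ω ∂μ = 0 :=
  calc ∫ ω, Y ω * X ω ∂μ = ∫ ω, μ[Y * X | m] ω ∂μ := (integral_condExp hm).symm
    _ = ∫ _, 0 ∂μ := integral_congr_ae <| by
      filter_upwards [condExp_mul_of_stronglyMeasurable_left hY hYX hX, h] with ω hω h0
      rw [hω, Pi.mul_apply, h0, Pi.zero_apply, mul_zero]
    _ = 0 := integral_zero _ _

lemma integrable_exp_sub_sq (hX : AEStronglyMeasurable X μ) :
    Integrable (fun ω => Real.exp (X ω - X ω ^ 2)) μ := by
  refine .of_bound (Real.continuous_exp.comp_aestronglyMeasurable (hX.sub (hX.pow 2))) 2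
    (.of_forall fun ω => ?_)
  rw [Real.norm_of_nonneg (Real.exp_pos _).le]
  exact exp_sub_sq_le_two _

lemma condExp_exp_sub_sq_le (hm : m ≤ m₀) (hX : MemLp X 2 μ) (h : μ[X | m] =ᵐ[μ] 0) :
    μ[fun ω => Real.exp (X ω - X ω ^ 2) | m] ≤ᵐ[μ]
      fun ω => Real.exp (μ[fun ω' => X ω' ^ 2 | m] ω) := by
  have hint : Integrable ((fun _ => (1 : ℝ)) + X) μ :=
    (integrable_const 1).add (hX.integrable one_le_two)
  filter_upwards [condExp_mono (m := m) (integrable_exp_sub_sq hX.1) (hint.add hX.integrable_sq)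
      (.of_forall fun ω => exp_sub_sq_le (X ω)), condExp_add hint hX.integrable_sq m,
    condExp_add (integrable_const 1) (hX.integrable one_le_two) m, h] with ω hle hadd₁ hadd₂ h0
  rw [hadd₁, Pi.add_apply, hadd₂, Pi.add_apply, h0, condExp_const hm, Pi.zero_apply] at hle
  linarith [Real.add_one_le_exp (μ[fun ω' => X ω' ^ 2 | m] ω)]

lemma integrable_exp_sub_sq_add_condExp (hm : m ≤ m₀) (hX : AEStronglyMeasurable X μ) :
    Integrable (fun ω => Real.exp (X ω - (X ω ^ 2 + μ[fun ω' => X ω' ^ 2 | m] ω))) μ := by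
  refine .of_bound (Real.continuous_exp.comp_aestronglyMeasurable (hX.sub ((hX.pow 2).add
    (stronglyMeasurable_condExp.mono hm).aestronglyMeasurable))) 2 ?_
  filter_upwards [ae_exp_sub_sq_add_condExp_le (m := m) (X := X)] with ω hω
  rwa [Real.norm_of_nonneg (Real.exp_pos _).le]

lemma condExp_exp_sub_sq_add_condExp_le_one (hm : m ≤ m₀) (hX : MemLp X 2 μ)
    (h : μ[X | m] =ᵐ[μ] 0) :
    μ[fun ω => Real.exp (X ω - (X ω ^ 2 + μ[fun ω' => X ω' ^ 2 | m] ω)) | m] ≤ᵐ[μ] 1 := by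
  set V : Ω → ℝ := μ[fun ω => X ω ^ 2 | m]
  have hV : StronglyMeasurable[m] fun ω => Real.exp (-V ω) :=
    Real.continuous_exp.comp_stronglyMeasurable stronglyMeasurable_condExp.neg
  have hfactor : (fun ω => Real.exp (X ω - (X ω ^ 2 + V ω))) =
      (fun ω => Real.exp (-V ω)) * fun ω => Real.exp (X ω - X ω ^ 2) := by
    ext ω
    rw [Pi.mul_apply, ← Real.exp_add]
    ring_nf
  have hint := integrable_exp_sub_sq_add_condExp hm hX.1
  change Integrable (fun ω => Real.exp (X ω - (X ω ^ 2 + V ω))) μ at hint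
  rw [hfactor] at hint ⊢
  filter_upwards [condExp_mul_of_stronglyMeasurable_left hV hint (integrable_exp_sub_sq hX.1),
    condExp_exp_sub_sq_le hm hX h] with ω hpull hle
  calc _ = Real.exp (-V ω) * μ[fun ω => Real.exp (X ω - X ω ^ 2) | m] ω := hpull
    _ ≤ Real.exp (-V ω) * Real.exp (V ω) := by gcongr
    _ = 1 := by rw [← Real.exp_add, neg_add_cancel, Real.exp_zero]

end CondExp

/-- `X` is a martingale difference with respect to the filtration `ℱ`, in the sense of general
probability theory; no condition is imposed on the mean of `X 0`. -/
structure MartingaleDifference {Ω : Type*} {m₀ : MeasurableSpace Ω} (X : ℕ → Ω → ℝ)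
    (ℱ : Filtration ℕ m₀) (μ : Measure Ω) : Prop where
  stronglyAdapted : StronglyAdapted ℱ X
  integrable : ∀ n, Integrable (X n) μ
  condExp_ae_eq_zero : ∀ n, μ[X (n + 1) | ℱ n] =ᵐ[μ] 0

/-- The `n`-th increment of the sum of the square bracket `[X]` and the angle bracket `⟨X⟩` of the
martingale with differences `X`; the variance at time `0` is not included. It is the compensator
in the exponential supermartingale below. -/
noncomputable def bracketIncrement {Ω : Type*} {m₀ : MeasurableSpace Ω} (X : ℕ → Ω → ℝ)
    (ℱ : Filtration ℕ m₀) (μ : Measure Ω) : ℕ → Ω → ℝ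
  | 0, ω => X 0 ω ^ 2
  | n + 1, ω => X (n + 1) ω ^ 2 + μ[fun ω' => X (n + 1) ω' ^ 2 | ℱ n] ω

/-- The exponential of the martingale with differences `X`, compensated by its brackets so as to
become a supermartingale. -/
noncomputable def compensatedExp {Ω : Type*} {m₀ : MeasurableSpace Ω} (X : ℕ → Ω → ℝ)
    (ℱ : Filtration ℕ m₀) (μ : Measure Ω) (n : ℕ) (ω : Ω) : ℝ :=
  Real.exp (∑ j ∈ Finset.range (n + 1), (X j ω - bracketIncrement X ℱ μ j ω))

section Bracket

variable {Ω : Type*} {m₀ : MeasurableSpace Ω} {X : ℕ → Ω → ℝ} {ℱ : Filtration ℕ m₀}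
  {μ : Measure Ω}

lemma bracketIncrement_nonneg : ∀ᵐ ω ∂μ, ∀ n, 0 ≤ bracketIncrement X ℱ μ n ω := by
  refine ae_all_iff.2 fun n => ?_
  cases n with
  | zero => exact .of_forall fun ω => sq_nonneg (X 0 ω)
  | succ n =>
    filter_upwards [condExp_nonneg (m := ℱ n) (.of_forall fun ω => sq_nonneg (X (n + 1) ω))]
      with ω hω using add_nonneg (sq_nonneg _) hω

lemma bracketIncrement_const_mul (r : ℕ → ℝ) :
    ∀ᵐ ω ∂μ, ∀ n, bracketIncrement (fun j ω => r j * X j ω) ℱ μ n ω =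
      r n ^ 2 * bracketIncrement X ℱ μ n ω := by
  refine ae_all_iff.2 fun n => ?_
  cases n with
  | zero => exact .of_forall fun ω => mul_pow (r 0) (X 0 ω) 2
  | succ n =>
    filter_upwards [condExp_smul (μ := μ) (r (n + 1) ^ 2) (fun ω => X (n + 1) ω ^ 2) (ℱ n)]
      with ω hω
    simp only [bracketIncrement, mul_pow, mul_add]
    exact congrArg _ hω

lemma stronglyAdapted_bracketIncrement (hX : StronglyAdapted ℱ X) :
    StronglyAdapted ℱ (bracketIncrement X ℱ μ) := fun n => by
  cases n with
  | zero => exact (hX 0).pow 2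
  | succ n =>
    exact ((hX _).pow 2).add (stronglyMeasurable_condExp.mono (ℱ.mono n.le_succ))

lemma integrable_bracketIncrement (hX : ∀ n, MemLp (X n) 2 μ) (n : ℕ) :
    Integrable (bracketIncrement X ℱ μ n) μ := by
  cases n with
  | zero => exact (hX 0).integrable_sq
  | succ => exact (hX _).integrable_sq.add integrable_condExp

lemma integral_bracketIncrement_le [IsFiniteMeasure μ] (hX : ∀ n, MemLp (X n) 2 μ) (n : ℕ) :
    ∫ ω, bracketIncrement X ℱ μ n ω ∂μ ≤ 2 * ∫ ω, X n ω ^ 2 ∂μ := by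
  cases n with
  | zero =>
    have h : 0 ≤ ∫ ω, X 0 ω ^ 2 ∂μ := integral_nonneg fun ω => sq_nonneg (X 0 ω)
    simp only [bracketIncrement]
    linarith
  | succ n =>
    simp only [bracketIncrement]
    rw [integral_add (hX _).integrable_sq integrable_condExp, integral_condExp (ℱ.le n), two_mul]

lemma stronglyAdapted_compensatedExp (hX : StronglyAdapted ℱ X) :
    StronglyAdapted ℱ (compensatedExp X ℱ μ) := fun _ =>
  Real.continuous_exp.comp_stronglyMeasurable <| Finset.stronglyMeasurable_fun_sum _ fun j hj =>
    ((hX j).sub (stronglyAdapted_bracketIncrement hX j)).mono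
      (ℱ.mono (Nat.lt_succ_iff.1 (Finset.mem_range.1 hj)))

lemma compensatedExp_zero_le_two (ω : Ω) : compensatedExp X ℱ μ 0 ω ≤ 2 := by
  simpa only [compensatedExp, zero_add, Finset.sum_range_one, bracketIncrement] using
    exp_sub_sq_le_two (X 0 ω)

lemma compensatedExp_succ (n : ℕ) :
    compensatedExp X ℱ μ (n + 1) = compensatedExp X ℱ μ n *
      fun ω => Real.exp (X (n + 1) ω - bracketIncrement X ℱ μ (n + 1) ω) := by
  ext ω
  rw [Pi.mul_apply, compensatedExp, Finset.sum_range_succ, Real.exp_add, compensatedExp]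

variable [IsFiniteMeasure μ]

lemma integrable_compensatedExp (hX : StronglyAdapted ℱ X) (n : ℕ) :
    Integrable (compensatedExp X ℱ μ n) μ := by
  induction n with
  | zero =>
    refine .of_bound ((stronglyAdapted_compensatedExp hX 0).mono (ℱ.le 0)).aestronglyMeasurable 2
      (.of_forall fun ω => ?_)
    rw [compensatedExp, Real.norm_of_nonneg (Real.exp_pos _).le]
    exact compensatedExp_zero_le_two ω
  | succ n ih =>
    rw [compensatedExp_succ]
    refine ih.mul_bdd (c := 2) (integrable_exp_sub_sq_add_condExp (ℱ.le n)
      ((hX (n + 1)).mono (ℱ.le _)).aestronglyMeasurable).1 ?_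
    filter_upwards [ae_exp_sub_sq_add_condExp_le (m := ℱ n) (X := X (n + 1))] with ω hω
    rwa [Real.norm_of_nonneg (Real.exp_pos _).le]

end Bracket

lemma exists_filter_lt_eq_filter_le {ι α : Type*} [LinearOrder α] {B : Finset ι} {τ : ι → α} {a : α}
    (h : {i ∈ B | τ i < a}.Nonempty) : ∃ m ∈ B, {i ∈ B | τ i < a} = {i ∈ B | τ i ≤ τ m} := by
  obtain ⟨m, hm, hmax⟩ := Finset.exists_max_image _ τ h
  simp only [Finset.mem_filter] at hm hmax
  exact ⟨m, hm.1, Finset.filter_congr fun i hi =>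
    ⟨fun hia => hmax i ⟨hi, hia⟩, fun him => him.trans_lt hm.2⟩⟩

namespace MartingaleDifference

variable {Ω : Type*} {m₀ : MeasurableSpace Ω} {X : ℕ → Ω → ℝ} {ℱ : Filtration ℕ m₀}
  {μ : Measure Ω}

lemma const_mul (hX : MartingaleDifference X ℱ μ) (r : ℕ → ℝ) :
    MartingaleDifference (fun j ω => r j * X j ω) ℱ μ where
  stronglyAdapted n := (hX.stronglyAdapted n).const_mul (r n)
  integrable n := (hX.integrable n).const_mul (r n)
  condExp_ae_eq_zero n := by
    filter_upwards [condExp_smul (μ := μ) (r (n + 1)) (X (n + 1)) (ℱ n), hX.condExp_ae_eq_zero n]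
      with ω hsmul h0
    calc _ = r (n + 1) * μ[X (n + 1) | ℱ n] ω := hsmul
      _ = 0 := by rw [h0, Pi.zero_apply, mul_zero]

variable [IsFiniteMeasure μ]

lemma supermartingale_compensatedExp (hX : MartingaleDifference X ℱ μ)
    (hX2 : ∀ n, MemLp (X n) 2 μ) : Supermartingale (compensatedExp X ℱ μ) ℱ μ := by
  have hadapted := stronglyAdapted_compensatedExp (μ := μ) hX.stronglyAdapted
  have hint := integrable_compensatedExp (μ := μ) hX.stronglyAdapted
  refine supermartingale_nat hadapted hint fun n => ?_
  have hint' := hint (n + 1)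
  rw [compensatedExp_succ] at hint' ⊢
  filter_upwards [condExp_mul_of_stronglyMeasurable_left (hadapted n) hint'
      (integrable_exp_sub_sq_add_condExp (ℱ.le n) (hX2 (n + 1)).1),
    condExp_exp_sub_sq_add_condExp_le_one (ℱ.le n) (hX2 (n + 1)) (hX.condExp_ae_eq_zero n)]
    with ω hpull hle
  exact hpull.le.trans (mul_le_of_le_one_right (Real.exp_pos _).le hle)

lemma integral_compensatedExp_le (hX : MartingaleDifference X ℱ μ)
    (hX2 : ∀ n, MemLp (X n) 2 μ) (n : ℕ) :
    ∫ ω, compensatedExp X ℱ μ n ω ∂μ ≤ 2 * μ.real Set.univ := by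
  have hdecr := (hX.supermartingale_compensatedExp hX2).setIntegral_le n.zero_le .univ
  rw [setIntegral_univ, setIntegral_univ] at hdecr
  calc ∫ ω, compensatedExp X ℱ μ n ω ∂μ ≤ ∫ ω, compensatedExp X ℱ μ 0 ω ∂μ := hdecr
    _ ≤ ∫ _, 2 ∂μ := integral_mono (integrable_compensatedExp hX.stronglyAdapted 0)
      (integrable_const 2) compensatedExp_zero_le_two
    _ = 2 * μ.real Set.univ := by rw [integral_const, smul_eq_mul, mul_comm]

lemma measureReal_le_sum_range_sub_bracketIncrement_le (hX : MartingaleDifference X ℱ μ)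
    (hX2 : ∀ n, MemLp (X n) 2 μ) (n : ℕ) (u : ℝ) :
    μ.real {ω | u ≤ ∑ j ∈ Finset.range (n + 1), (X j ω - bracketIncrement X ℱ μ j ω)} ≤
      2 * μ.real Set.univ * Real.exp (-u) := by
  have hmarkov := (mul_meas_ge_le_integral_of_nonneg (.of_forall fun ω => (Real.exp_pos _).le)
    (integrable_compensatedExp hX.stronglyAdapted n) (Real.exp u)).trans
    (hX.integral_compensatedExp_le hX2 n)
  simp only [Real.exp_le_exp] at hmarkov
  rwa [Real.exp_neg, ← div_eq_mul_inv, le_div_iff₀' (Real.exp_pos u)]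

lemma measureReal_le_sum_mul_sub_bracketIncrement_le (hX : MartingaleDifference X ℱ μ)
    (hX2 : ∀ n, MemLp (X n) 2 μ) (J : Finset ℕ) (r : ℕ → ℝ) (u : ℝ) :
    μ.real {ω | u ≤ ∑ j ∈ J, (r j * X j ω - r j ^ 2 * bracketIncrement X ℱ μ j ω)} ≤
      2 * μ.real Set.univ * Real.exp (-u) := by
  let r' : ℕ → ℝ := fun j => if j ∈ J then r j else 0
  have hJ : J ⊆ Finset.range (J.sup id + 1) := fun j hj =>
    Finset.mem_range.2 (Nat.lt_succ_of_le (Finset.le_sup (f := id) hj))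
  refine le_of_eq_of_le (measureReal_congr ?_) <|
    (hX.const_mul r').measureReal_le_sum_range_sub_bracketIncrement_le
      (fun n => (hX2 n).const_mul (r' n)) (J.sup id) u
  filter_upwards [bracketIncrement_const_mul (X := X) (ℱ := ℱ) (μ := μ) r'] with ω hω
  refine congrArg (u ≤ ·) ?_
  rw [← Finset.sum_subset hJ fun j _ hj => by
    simp only [hω, r', if_neg hj, zero_mul, zero_pow two_ne_zero, sub_self]]
  exact Finset.sum_congr rfl fun j hj => by simp only [hω, r', if_pos hj]

lemma measureReal_le_abs_sum_le (hX : MartingaleDifference X ℱ μ)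
    (hX2 : ∀ n, MemLp (X n) 2 μ) (J : Finset ℕ) {t : ℝ} (ht : 0 < t) (u : ℝ) :
    μ.real {ω | u / t + t * ∑ j ∈ J, bracketIncrement X ℱ μ j ω ≤ |∑ j ∈ J, X j ω|} ≤
      4 * μ.real Set.univ * Real.exp (-u) := by
  have hchernoff := fun s => hX.measureReal_le_sum_mul_sub_bracketIncrement_le hX2 J (fun _ => s) u
  refine (measureReal_mono fun ω hω => ?_).trans <| (measureReal_union_le _ _).trans <|
    (add_le_add (hchernoff t) (hchernoff (-t))).trans_eq (by ring)
  have hscaled := mul_le_mul_of_nonneg_left (Set.mem_ofPred_eq ▸ hω) ht.le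
  simp only [Set.mem_union, Set.mem_ofPred_eq, Finset.sum_sub_distrib, ← Finset.mul_sum, neg_sq]
  rw [mul_add, mul_div_cancel₀ _ ht.ne'] at hscaled
  rcases abs_choice (∑ j ∈ J, X j ω) with h | h <;> rw [h] at hscaled
  · exact .inl (by linarith)
  · exact .inr (by linarith)

section Rearrangement

variable {ι : Type*} {G : ι → Finset ℕ} (τ : ι → ℕ)

lemma measureReal_exists_lt_abs_sum_filter_le (hX : MartingaleDifference X ℱ μ)
    (hX2 : ∀ n, MemLp (X n) 2 μ) (hG : Pairwise (Function.onFun Disjoint G)) (B : Finset ι)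
    {t u : ℝ} (ht : 0 < t) (hu : 0 ≤ u) :
    μ.real {ω | ∃ M, u / t + t * ∑ i ∈ B, ∑ j ∈ G i, bracketIncrement X ℱ μ j ω <
        |∑ i ∈ B with τ i < M, ∑ j ∈ G i, X j ω|} ≤
      B.card * (4 * μ.real Set.univ * Real.exp (-u)) := by
  classical
  let J : ι → Finset ℕ := fun m => {i ∈ B | τ i ≤ τ m}.biUnion G
  have hsum : ∀ (S : Finset ι) (v : ℕ → ℝ), ∑ j ∈ S.biUnion G, v j = ∑ i ∈ S, ∑ j ∈ G i, v j :=
    fun S v => Finset.sum_biUnion fun i _ i' _ hne => hG hne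
  calc _ ≤ μ.real (⋃ m ∈ B, {ω | u / t + t * ∑ j ∈ J m, bracketIncrement X ℱ μ j ω ≤
          |∑ j ∈ J m, X j ω|}) := ?_
    _ ≤ ∑ m ∈ B, _ := measureReal_biUnion_finset_le _ _
    _ ≤ B.card • (4 * μ.real Set.univ * Real.exp (-u)) :=
      Finset.sum_le_card_nsmul _ _ _ fun m _ => hX.measureReal_le_abs_sum_le hX2 (J m) ht u
    _ = _ := nsmul_eq_mul _ _
  refine ENNReal.toReal_mono (measure_ne_top _ _) (measure_mono_ae ?_)
  filter_upwards [bracketIncrement_nonneg (X := X) (ℱ := ℱ) (μ := μ)] with ω hω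
  rintro ⟨M, hM⟩
  have hnonneg : ∀ i ∈ B, 0 ≤ ∑ j ∈ G i, bracketIncrement X ℱ μ j ω :=
    fun i _ => Finset.sum_nonneg fun j _ => hω j
  obtain hempty | hne := {i ∈ B | τ i < M}.eq_empty_or_nonempty
  · rw [hempty, Finset.sum_empty, abs_zero] at hM
    exact absurd hM (not_lt.2 (add_nonneg (div_nonneg hu ht.le)
      (mul_nonneg ht.le (Finset.sum_nonneg hnonneg))))
  · obtain ⟨m, hmB, hm⟩ := exists_filter_lt_eq_filter_le hne
    have hsegment : ∑ i ∈ B with τ i ≤ τ m, ∑ j ∈ G i, bracketIncrement X ℱ μ j ω ≤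
        ∑ i ∈ B, ∑ j ∈ G i, bracketIncrement X ℱ μ j ω :=
      Finset.sum_le_sum_of_subset_of_nonneg (Finset.filter_subset _ _) fun i hi _ => hnonneg i hi
    refine Set.mem_biUnion hmB ?_
    simp only [J, Set.mem_ofPred_eq, hsum]
    refine le_trans ?_ (hm ▸ hM.le)
    gcongr

lemma ae_eventually_abs_sum_filter_le (hX : MartingaleDifference X ℱ μ)
    (hX2 : ∀ n, MemLp (X n) 2 μ) (hG : Pairwise (Function.onFun Disjoint G)) {B : ℕ → Finset ι}
    {t u : ℕ → ℝ} (ht : ∀ k, 0 < t k) (hu : ∀ k, 0 ≤ u k)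
    (hsum : Summable fun k => ((B k).card : ℝ) * Real.exp (-u k)) :
    ∀ᵐ ω ∂μ, ∀ᶠ k in atTop, ∀ M, |∑ i ∈ B k with τ i < M, ∑ j ∈ G i, X j ω| ≤
      u k / t k + t k * ∑ i ∈ B k, ∑ j ∈ G i, bracketIncrement X ℱ μ j ω := by
  let bad : ℕ → Set Ω := fun k =>
    {ω | ∃ M, u k / t k + t k * ∑ i ∈ B k, ∑ j ∈ G i, bracketIncrement X ℱ μ j ω <
      |∑ i ∈ B k with τ i < M, ∑ j ∈ G i, X j ω|}
  have hreal : Summable fun k => μ.real (bad k) :=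
    (hsum.mul_left (4 * μ.real Set.univ)).of_nonneg_of_le (fun k => measureReal_nonneg) fun k =>
      (hX.measureReal_exists_lt_abs_sum_filter_le τ hX2 hG (B k) (ht k) (hu k)).trans_eq (by ring)
  have hfinite : ∑' k, μ (bad k) ≠ ⊤ :=
    ne_of_eq_of_ne (tsum_congr fun k => (ofReal_measureReal).symm) hreal.tsum_ofReal_ne_top
  filter_upwards [ae_eventually_notMem hfinite] with ω hω
  filter_upwards [hω] with k hk
  simpa only [bad, Set.mem_ofPred_eq, not_exists, not_lt] using hk

end Rearrangement

end MartingaleDifference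

lemma ae_summable_norm_of_summable_integral_norm {Ω E : Type*} {m₀ : MeasurableSpace Ω}
    {μ : Measure Ω} [NormedAddCommGroup E] {F : ℕ → Ω → E} (hF : ∀ n, Integrable (F n) μ)
    (h : Summable fun n => ∫ ω, ‖F n ω‖ ∂μ) : ∀ᵐ ω ∂μ, Summable fun n => ‖F n ω‖ := by
  refine summable_norm_of_tsum_eLpNorm_ne_top le_rfl (fun n => (hF n).1) ?_
  simpa only [eLpNorm_one_eq_lintegral_enorm, ofReal_integral_norm_eq_lintegral_enorm (hF _)] using
    h.tsum_ofReal_ne_top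

lemma integral_mul_self_eq_one_of_eLpNorm_eq_one {Ω : Type*} {m₀ : MeasurableSpace Ω}
    {μ : Measure Ω} {g : Ω → ℝ} (hg : AEStronglyMeasurable g μ) (h : eLpNorm g 2 μ = 1) :
    ∫ ω, g ω * g ω ∂μ = 1 := by
  have hg2 : MemLp g 2 μ := ⟨hg, h ▸ ENNReal.one_lt_top⟩
  rw [hg2.eLpNorm_eq_integral_rpow_norm two_ne_zero ENNReal.ofNat_ne_top,
    ENNReal.ofReal_eq_one, ENNReal.toReal_ofNat, ← one_div, ← Real.sqrt_eq_rpow,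
    Real.sqrt_eq_one] at h
  simpa only [Real.rpow_ofNat, Real.norm_eq_abs, sq, abs_mul_abs_self] using h

lemma exists_forall_mem_eq_and_eq_zero {ι α R : Type*} [Zero R] {G : ι → Finset α}
    (hG : Pairwise (Function.onFun Disjoint G)) (a : ι → R) :
    ∃ r : α → R, (∀ i, ∀ j ∈ G i, r j = a i) ∧ ∀ j, (∀ i, j ∉ G i) → r j = 0 := by
  classical
  refine ⟨fun j => if h : ∃ i, j ∈ G i then a h.choose else 0, fun i j hj => ?_,
    fun j hj => dif_neg (not_exists.2 hj)⟩
  have h : ∃ i, j ∈ G i := ⟨i, hj⟩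
  exact (dif_pos h).trans <|
    congrArg a (hG.eq (Finset.not_disjoint_iff.2 ⟨j, h.choose_spec, hj⟩))

namespace MartingaleDifference

variable {Ω : Type*} {m₀ : MeasurableSpace Ω} {X : ℕ → Ω → ℝ} {ℱ : Filtration ℕ m₀}
  {μ : Measure Ω} [IsFiniteMeasure μ]

lemma condExp_sum_insert_succ (hX : MartingaleDifference X ℱ μ) {J : Finset ℕ} {n : ℕ}
    (hJ : ∀ j ∈ J, j < n + 1) :
    μ[fun ω => ∑ j ∈ insert (n + 1) J, X j ω | ℱ n] =ᵐ[μ] fun ω => ∑ j ∈ J, X j ω := by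
  have hmeas : StronglyMeasurable[ℱ n] fun ω => ∑ j ∈ J, X j ω :=
    Finset.stronglyMeasurable_fun_sum _ fun j hj =>
      (hX.stronglyAdapted j).mono (ℱ.mono (Nat.lt_succ_iff.1 (hJ j hj)))
  have hint : Integrable (fun ω => ∑ j ∈ J, X j ω) μ :=
    integrable_finsetSum _ fun j _ => hX.integrable j
  have hsplit : (fun ω => ∑ j ∈ insert (n + 1) J, X j ω) =
      X (n + 1) + fun ω => ∑ j ∈ J, X j ω := by
    ext ω
    rw [Finset.sum_insert fun h => (hJ _ h).false, Pi.add_apply]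
  rw [hsplit]
  filter_upwards [condExp_add (hX.integrable (n + 1)) hint (ℱ n), hX.condExp_ae_eq_zero n]
    with ω hadd h0
  rw [hadd, Pi.add_apply, h0, condExp_of_stronglyMeasurable (ℱ.le n) hmeas hint, Pi.zero_apply,
    zero_add]

lemma memLp_of_memLp_sum (hX : MartingaleDifference X ℱ μ) {p : ENNReal} (hp : 1 ≤ p)
    {J : Finset ℕ} (h : MemLp (fun ω => ∑ j ∈ J, X j ω) p μ) : ∀ j ∈ J, MemLp (X j) p μ := by
  induction J using Finset.induction_on_max with
  | empty => exact fun j hj => absurd hj (Finset.notMem_empty j)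
  | insert k J hJ ih =>
    have hinit : MemLp (fun ω => ∑ j ∈ J, X j ω) p μ := by
      cases k with
      | zero => simp [Finset.eq_empty_of_forall_notMem fun j hj => (hJ j hj).not_ge j.zero_le]
      | succ n => exact (h.condExp hp).ae_eq (hX.condExp_sum_insert_succ hJ)
    have hlast : MemLp (X k) p μ := by
      convert h.sub hinit using 1
      ext ω
      rw [Pi.sub_apply, Finset.sum_insert fun hk => (hJ k hk).false, add_sub_cancel_right]
    exact Finset.forall_mem_insert .. |>.2 ⟨hlast, ih hinit⟩

lemma integral_mul_eq_zero_of_lt (hX : MartingaleDifference X ℱ μ) (hX2 : ∀ n, MemLp (X n) 2 μ)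
    {i j : ℕ} (hij : i < j) : ∫ ω, X i ω * X j ω ∂μ = 0 := by
  obtain ⟨n, rfl⟩ := Nat.exists_eq_succ_of_ne_zero (Nat.ne_zero_of_lt hij)
  exact integral_mul_eq_zero_of_condExp_ae_eq_zero (ℱ.le n)
    ((hX.stronglyAdapted i).mono (ℱ.mono (Nat.lt_succ_iff.1 hij))) (hX.integrable (n + 1))
    ((hX2 i).integrable_mul (hX2 (n + 1))) (hX.condExp_ae_eq_zero n)

lemma integral_sum_mul_sum (hX : MartingaleDifference X ℱ μ) (hX2 : ∀ n, MemLp (X n) 2 μ)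
    (s t : Finset ℕ) :
    ∫ ω, (∑ i ∈ s, X i ω) * ∑ j ∈ t, X j ω ∂μ = ∑ i ∈ s ∩ t, ∫ ω, X i ω ^ 2 ∂μ := by
  have hint : ∀ i j, Integrable (fun ω => X i ω * X j ω) μ :=
    fun i j => (hX2 i).integrable_mul (hX2 j)
  have horth : ∀ i j, ∫ ω, X i ω * X j ω ∂μ = if i = j then ∫ ω, X i ω ^ 2 ∂μ else 0 :=
    fun i j => by
      rcases lt_trichotomy i j with h | rfl | h
      · rw [hX.integral_mul_eq_zero_of_lt hX2 h, if_neg h.ne]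
      · simp only [if_true, sq]
      · simp only [mul_comm (X i _), hX.integral_mul_eq_zero_of_lt hX2 h, if_neg h.ne']
  calc ∫ ω, (∑ i ∈ s, X i ω) * ∑ j ∈ t, X j ω ∂μ = ∑ i ∈ s, ∑ j ∈ t, ∫ ω, X i ω * X j ω ∂μ := by
        simp only [Finset.sum_mul_sum]
        rw [integral_finsetSum _ fun i _ => integrable_finsetSum _ fun j _ => hint i j]
        exact Finset.sum_congr rfl fun i _ => integral_finsetSum _ fun j _ => hint i j
    _ = ∑ i ∈ s ∩ t, ∫ ω, X i ω ^ 2 ∂μ := by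
        simp only [horth, Finset.sum_ite_eq, Finset.sum_ite_mem]

lemma integral_sum_bracketIncrement_le (hX : MartingaleDifference X ℱ μ)
    (hX2 : ∀ n, MemLp (X n) 2 μ) (J : Finset ℕ) :
    ∫ ω, ∑ j ∈ J, bracketIncrement X ℱ μ j ω ∂μ ≤ 2 * ∫ ω, (∑ j ∈ J, X j ω) ^ 2 ∂μ :=
  calc ∫ ω, ∑ j ∈ J, bracketIncrement X ℱ μ j ω ∂μ
      = ∑ j ∈ J, ∫ ω, bracketIncrement X ℱ μ j ω ∂μ :=
        integral_finsetSum _ fun j _ => integrable_bracketIncrement hX2 j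
    _ ≤ ∑ j ∈ J, 2 * ∫ ω, X j ω ^ 2 ∂μ :=
        Finset.sum_le_sum fun j _ => integral_bracketIncrement_le hX2 j
    _ = 2 * ∫ ω, (∑ j ∈ J, X j ω) ^ 2 ∂μ := by
        simp only [← Finset.mul_sum, sq (∑ j ∈ J, X j _), hX.integral_sum_mul_sum hX2,
          Finset.inter_self]

section Convergence

variable {G : ℕ → Finset ℕ} {w : ℕ → ℝ}

lemma ae_summable_mul_sum_bracketIncrement (hX : MartingaleDifference X ℱ μ)
    (hX2 : ∀ n, MemLp (X n) 2 μ) (hw : ∀ n, 0 ≤ w n)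
    (h : Summable fun n => w n * ∫ ω, (∑ j ∈ G n, X j ω) ^ 2 ∂μ) :
    ∀ᵐ ω ∂μ, Summable fun n => w n * ∑ j ∈ G n, bracketIncrement X ℱ μ j ω := by
  have hnonneg : ∀ n, ∀ᵐ ω ∂μ, 0 ≤ w n * ∑ j ∈ G n, bracketIncrement X ℱ μ j ω := fun n => by
    filter_upwards [bracketIncrement_nonneg (X := X) (ℱ := ℱ) (μ := μ)] with ω hω
    exact mul_nonneg (hw n) (Finset.sum_nonneg fun j _ => hω j)
  have hnorm : ∀ n, ∫ ω, ‖w n * ∑ j ∈ G n, bracketIncrement X ℱ μ j ω‖ ∂μ =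
      w n * ∫ ω, ∑ j ∈ G n, bracketIncrement X ℱ μ j ω ∂μ := fun n => by
    rw [← integral_const_mul]
    exact integral_congr_ae ((hnonneg n).mono fun ω hω => Real.norm_of_nonneg hω)
  have hae := ae_summable_norm_of_summable_integral_norm
    (F := fun n ω => w n * ∑ j ∈ G n, bracketIncrement X ℱ μ j ω) (μ := μ)
    (fun n => (integrable_finsetSum _ fun j _ => integrable_bracketIncrement hX2 j).const_mul _) <|
      (h.mul_left 2).of_nonneg_of_le (fun n => integral_nonneg fun ω => norm_nonneg _) fun n => by
        rw [hnorm, mul_left_comm]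
        exact mul_le_mul_of_nonneg_left (hX.integral_sum_bracketIncrement_le hX2 (G n)) (hw n)
  exact hae.mono fun ω hω => hω.of_norm

theorem ae_exists_tendsto_sum_comp_perm (hX : MartingaleDifference X ℱ μ)
    (hX2 : ∀ n, MemLp (X n) 2 μ) (hG : Pairwise (Function.onFun Disjoint G))
    (hpos : ∀ n, 0 < w n) (hmono : Monotone w) (hw : Summable fun k => 2 ^ k * (w (2 ^ 2 ^ k))⁻¹)
    (h : Summable fun n => w n * ∫ ω, (∑ j ∈ G n, X j ω) ^ 2 ∂μ) (σ : Equiv.Perm ℕ) :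
    ∀ᵐ ω ∂μ, ∃ l, Tendsto (fun N => ∑ n ∈ Finset.range N, ∑ j ∈ G (σ n), X j ω) atTop (𝓝 l) := by
  filter_upwards [bracketIncrement_nonneg (X := X) (ℱ := ℱ) (μ := μ),
    hX.ae_summable_mul_sum_bracketIncrement hX2 (fun n => (hpos n).le) h,
    hX.ae_eventually_abs_sum_filter_le σ.symm hX2 hG (fun k => hpos (2 ^ 2 ^ k))
      (u := fun k => 3 * 2 ^ k) (fun k => by positivity) summable_card_logLogBlock_mul_exp]
    with ω hbracket hsummable hblock
  refine exists_tendsto_sum_of_fiber_bound (y := fun n => ∑ j ∈ G n, X j ω) mem_logLogBlock σ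
    ((hw.mul_left 3).add (summable_sum_fiber mem_logLogBlock hsummable)) ?_
  filter_upwards [hblock, eventually_ne_atTop 0] with k hk hk0 M
  refine (hk M).trans ?_
  rw [mul_div_assoc, div_eq_mul_inv, Finset.mul_sum]
  gcongr with n hn
  · exact Finset.sum_nonneg fun j _ => hbracket j
  · exact hmono (two_pow_two_pow_le_of_mem_logLogBlock hk0 hn)

theorem ae_exists_tendsto_sum_mul_comp_perm (hX : MartingaleDifference X ℱ μ)
    (hX2 : ∀ n, MemLp (X n) 2 μ) (hG : Pairwise (Function.onFun Disjoint G))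
    (hpos : ∀ n, 0 < w n) (hmono : Monotone w) (hw : Summable fun k => 2 ^ k * (w (2 ^ 2 ^ k))⁻¹)
    {a : ℕ → ℝ} (h : Summable fun n => a n ^ 2 * w n * ∫ ω, (∑ j ∈ G n, X j ω) ^ 2 ∂μ)
    (σ : Equiv.Perm ℕ) :
    ∀ᵐ ω ∂μ, ∃ l,
      Tendsto (fun N => ∑ n ∈ Finset.range N, a (σ n) * ∑ j ∈ G (σ n), X j ω) atTop (𝓝 l) := by
  obtain ⟨r, hr, -⟩ := exists_forall_mem_eq_and_eq_zero hG a
  have hsum : ∀ n ω, ∑ j ∈ G n, r j * X j ω = a n * ∑ j ∈ G n, X j ω := fun n ω => by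
    rw [Finset.mul_sum]
    exact Finset.sum_congr rfl fun j hj => by rw [hr n j hj]
  have hr2 : Summable fun n => w n * ∫ ω, (∑ j ∈ G n, r j * X j ω) ^ 2 ∂μ := h.congr fun n => by
    simp only [hsum, mul_pow, integral_const_mul]
    ring
  simpa only [hsum] using (hX.const_mul r).ae_exists_tendsto_sum_comp_perm
    (fun n => (hX2 n).const_mul (r n)) hG hpos hmono hw hr2 σ

end Convergence

end MartingaleDifference

instance : IsFiniteMeasure unitMeasure := inferInstanceAs (IsFiniteMeasure (volume.restrict _))

/-- The σ-algebra of all sets which contain or avoid each set of the family `P`. For a countable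
partition `P` of the whole space it consists of the unions of members of `P`. -/
@[reducible] def atomSpace {Ω : Type*} (P : Set (Set Ω)) : MeasurableSpace Ω where
  MeasurableSet' s := ∀ A ∈ P, A ⊆ s ∨ Disjoint A s
  measurableSet_empty A _ := .inr (Set.disjoint_empty A)
  measurableSet_compl s hs A hA :=
    (hs A hA).symm.imp Set.subset_compl_iff_disjoint_right.2 Set.disjoint_compl_right_iff_subset.2
  measurableSet_iUnion s hs A hA := by
    by_cases h : ∃ i, A ⊆ s i
    · obtain ⟨i, hi⟩ := h
      exact .inl (hi.trans (Set.subset_iUnion s i))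
    · exact .inr (Set.disjoint_iUnion_right.2 fun i =>
        (hs i A hA).resolve_left fun hi => h ⟨i, hi⟩)

section AtomSpace

variable {Ω β : Type*} {P Q : Set (Set Ω)}

lemma atomSpace_mono (h : ∀ B ∈ Q, ∃ A ∈ P, B ⊆ A) : atomSpace P ≤ atomSpace Q :=
  fun _ hs B hB => by
    obtain ⟨A, hA, hBA⟩ := h B hB
    exact (hs A hA).imp hBA.trans (.mono_left hBA)

lemma measurable_atomSpace_of_const [MeasurableSpace β] {g : Ω → β}
    (h : ∀ A ∈ P, ∃ c, ∀ x ∈ A, g x = c) : Measurable[atomSpace P] g := fun s _ A hA => by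
  obtain ⟨c, hc⟩ := h A hA
  by_cases hcs : c ∈ s
  · exact .inl fun x hx => by rwa [Set.mem_preimage, hc x hx]
  · exact .inr (Set.disjoint_left.2 fun x hx => by rwa [Set.mem_preimage, hc x hx])

end AtomSpace

namespace IsPartition

variable {P : Set (Set ℝ)}

lemma subset_Ico (hP : IsPartition P) {A : Set ℝ} (hA : A ∈ P) : A ⊆ Set.Ico (0 : ℝ) 1 :=
  hP.sUnion_eq ▸ Set.subset_sUnion_of_mem hA

lemma ae_eq_sUnion_of_measurableSet_atomSpace (hP : IsPartition P) {s : Set ℝ}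
    (hs : MeasurableSet[atomSpace P] s) : s =ᵐ[unitMeasure] ⋃₀ {A ∈ P | A ⊆ s} := by
  filter_upwards [ae_restrict_mem measurableSet_Ico] with x hx
  obtain ⟨A, hA, hxA⟩ := hP.sUnion_eq.symm.subset hx
  refine propext ⟨fun hxs => ⟨A, ⟨hA, (hs A hA).resolve_right fun h => ?_⟩, hxA⟩, ?_⟩
  · exact Set.disjoint_left.1 h hxA hxs
  · rintro ⟨B, hB, hxB⟩
    exact hB.2 hxB

lemma setIntegral_eq_zero_of_measurableSet_atomSpace {E : Type*} [NormedAddCommGroup E]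
    [NormedSpace ℝ E] (hP : IsPartition P) {g : ℝ → E} (hg : Integrable g unitMeasure)
    (h : ∀ A ∈ P, ∫ x in A, g x = 0) {s : Set ℝ} (hs : MeasurableSet[atomSpace P] s) :
    ∫ x in s, g x ∂unitMeasure = 0 := by
  have : Countable ↥{A ∈ P | A ⊆ s} := (hP.countable.mono (Set.sep_subset _ _)).to_subtype
  rw [setIntegral_congr_set (hP.ae_eq_sUnion_of_measurableSet_atomSpace hs), Set.sUnion_eq_iUnion,
    integral_iUnion_ae _ _ hg.integrableOn]
  · refine (tsum_congr fun A => ?_).trans tsum_zero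
    rw [unitMeasure, Measure.restrict_restrict_of_subset (hP.subset_Ico A.2.1), h A A.2.1]
  · exact fun A => (hP.measurable A A.2.1).mono_ac Measure.absolutelyContinuous_restrict
  · exact fun A B hAB => (hP.disjoint A.2.1 B.2.1 (Subtype.coe_ne_coe.2 hAB)).aedisjoint

end IsPartition

namespace IsPartitionFiltration

variable {𝒜 : ℕ → Set (Set ℝ)}

lemma exists_superset (h𝒜 : IsPartitionFiltration 𝒜) {n : ℕ} {A : Set ℝ} (hA : A ∈ 𝒜 (n + 1)) :
    ∃ B ∈ 𝒜 n, A ⊆ B := by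
  have hcover : ∀ x ∈ Set.Ico (0 : ℝ) 1, ∃ B ∈ 𝒜 n, x ∈ B := fun x hx =>
    (h𝒜.partition n).sUnion_eq.symm.subset hx
  obtain rfl | ⟨x, hx⟩ := A.eq_empty_or_nonempty
  · obtain ⟨B, hB, -⟩ := hcover 0 ⟨le_rfl, one_pos⟩
    exact ⟨B, hB, Set.empty_subset B⟩
  · obtain ⟨B, hB, hxB⟩ := hcover x ((h𝒜.partition (n + 1)).subset_Ico hA hx)
    refine ⟨B, hB, ?_⟩
    obtain ⟨S, hS, rfl⟩ := h𝒜.refine_succ n B hB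
    obtain ⟨A', hA', hxA'⟩ := hxB
    obtain rfl := (h𝒜.partition (n + 1)).disjoint.elim_set hA (hS hA') x hx hxA'
    exact Set.subset_sUnion_of_mem hA'

/-- The filtration of σ-algebras generated by a filtration of partitions. The members of the
partitions are Lebesgue but not necessarily Borel measurable, so the σ-algebra at time `n` consists
of the Borel sets which agree almost everywhere with a union of members of `𝒜 n`. -/
noncomputable def toFiltration (h𝒜 : IsPartitionFiltration 𝒜) :
    Filtration ℕ (inferInstance : MeasurableSpace ℝ) where
  seq n := eventuallyMeasurableSpace (atomSpace (𝒜 n)) (ae unitMeasure) ⊓ inferInstance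
  mono' := monotone_nat_of_le_succ fun _ => inf_le_inf_right _ fun _ ⟨t, ht, hst⟩ =>
    ⟨t, atomSpace_mono (fun _ => h𝒜.exists_superset) t ht, hst⟩
  le' _ := inf_le_right

end IsPartitionFiltration

lemma IsMartingaleDifferenceOn.martingaleDifference {𝒜 : ℕ → Set (Set ℝ)} {f : ℕ → ℝ → ℝ}
    (hf : IsMartingaleDifferenceOn 𝒜 f) :
    MartingaleDifference (fun n => (hf.integrable n).1.mk (f n)) hf.filtration.toFiltration
      unitMeasure where
  stronglyAdapted n := by
    have hmk := (hf.integrable n).1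
    refine Measurable.stronglyMeasurable fun s hs => MeasurableSpace.measurableSet_inf.2
      ⟨?_, hmk.stronglyMeasurable_mk.measurable hs⟩
    exact (measurable_atomSpace_of_const (hf.constant_on n)).eventuallyMeasurable_of_eventuallyEq
      hmk.ae_eq_mk.symm hs
  integrable n := (hf.integrable n).congr (hf.integrable n).1.ae_eq_mk
  condExp_ae_eq_zero n := by
    have hint := hf.integrable (n + 1)
    refine (ae_eq_condExp_of_forall_setIntegral_eq (hf.filtration.toFiltration.le n)
      (hint.congr hint.1.ae_eq_mk) (fun s _ _ => integrableOn_zero) (fun s hs _ => ?_)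
      aestronglyMeasurable_zero).symm
    obtain ⟨t, ht, hst⟩ := (MeasurableSpace.measurableSet_inf.1 hs).1
    calc ∫ _ in s, (0 : ℝ) ∂unitMeasure = 0 := integral_zero _ _
      _ = ∫ x in t, f (n + 1) x ∂unitMeasure :=
        ((hf.filtration.partition n).setIntegral_eq_zero_of_measurableSet_atomSpace hint
          (hf.integral_eq_zero n) ht).symm
      _ = ∫ x in s, f (n + 1) x ∂unitMeasure := (setIntegral_congr_set hst).symm
      _ = ∫ x in s, hint.1.mk (f (n + 1)) x ∂unitMeasure :=
        integral_congr_ae (ae_restrict_of_ae hint.1.ae_eq_mk)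

lemma exists_martingaleDifference_of_isNonOverlappingPolynomials {f p : ℕ → ℝ → ℝ}
    (hf : IsMartingaleDifference f) (hp : IsNonOverlappingPolynomials f p)
    (hp2 : ∀ n, eLpNorm (p n) 2 unitMeasure < ⊤) :
    ∃ (ℱ : Filtration ℕ (inferInstance : MeasurableSpace ℝ)) (X : ℕ → ℝ → ℝ) (G : ℕ → Finset ℕ),
      MartingaleDifference X ℱ unitMeasure ∧ (∀ n, MemLp (X n) 2 unitMeasure) ∧
      Pairwise (Function.onFun Disjoint G) ∧
      ∀ n, p n =ᵐ[unitMeasure] fun x => ∑ j ∈ G n, X j x := by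
  obtain ⟨𝒜, hf⟩ := hf
  obtain ⟨G, c, hdisj, hpG⟩ := hp
  have hG : Pairwise (Function.onFun Disjoint G) := fun m n => hdisj m n
  -- Only the terms `c j * f j` which occur in some `p n` are known to be square integrable, so the
  -- others are replaced by zero.
  obtain ⟨r, hr, hr0⟩ := exists_forall_mem_eq_and_eq_zero hG fun _ => (1 : ℝ)
  have hX := hf.martingaleDifference.const_mul fun j => r j * c j
  have hpX : ∀ n, p n =ᵐ[unitMeasure] fun x =>
      ∑ j ∈ G n, r j * c j * (hf.integrable j).1.mk (f j) x := fun n => by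
    filter_upwards [ae_restrict_mem measurableSet_Ico,
      ae_all_iff.2 fun j => (hf.integrable j).1.ae_eq_mk] with x hx hfx
    rw [hpG n x hx]
    exact Finset.sum_congr rfl fun j hj => by rw [hfx, hr n j hj, one_mul]
  refine ⟨_, _, G, hX, fun j => ?_, hG, hpX⟩
  by_cases hj : ∃ n, j ∈ G n
  · obtain ⟨n, hjn⟩ := hj
    refine hX.memLp_of_memLp_sum one_le_two ⟨?_, ?_⟩ j hjn
    · exact (integrable_finsetSum _ fun j _ => hX.integrable j).1
    · exact (eLpNorm_congr_ae (hpX n)).symm.trans_lt (hp2 n)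
  · simp only [hr0 j (not_exists.1 hj), zero_mul, MemLp.zero']

lemma MartingaleDifference.isOrthonormalSystem {X : ℕ → ℝ → ℝ}
    {ℱ : Filtration ℕ (inferInstance : MeasurableSpace ℝ)}
    (hX : MartingaleDifference X ℱ unitMeasure) (hX2 : ∀ n, MemLp (X n) 2 unitMeasure)
    {G : ℕ → Finset ℕ} (hG : Pairwise (Function.onFun Disjoint G)) {p : ℕ → ℝ → ℝ}
    (hp : ∀ n, p n =ᵐ[unitMeasure] fun x => ∑ j ∈ G n, X j x)
    (hnorm : ∀ n, eLpNorm (p n) 2 unitMeasure = 1) : IsOrthonormalSystem p where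
  memLp n := (memLp_finsetSum _ fun j _ => hX2 j).ae_eq (hp n).symm
  norm_eq_one n := integral_mul_self_eq_one_of_eLpNorm_eq_one
    ((memLp_finsetSum _ fun j _ => hX2 j).ae_eq (hp n).symm).1 (hnorm n)
  orthogonal m n hmn :=
    calc ∫ x, p m x * p n x ∂unitMeasure
        = ∫ x, (∑ i ∈ G m, X i x) * ∑ j ∈ G n, X j x ∂unitMeasure :=
          integral_congr_ae ((hp m).mul (hp n))
      _ = ∑ i ∈ G m ∩ G n, ∫ x, X i x ^ 2 ∂unitMeasure := hX.integral_sum_mul_sum hX2 _ _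
      _ = 0 := by rw [Finset.disjoint_iff_inter_eq_empty.1 (hG hmn), Finset.sum_empty]

end WeylMultipliers

theorem corollary3_general
    (f : ℕ → ℝ → ℝ) (hf : WeylMultipliers.IsMartingaleDifference f)
    (p : ℕ → ℝ → ℝ) (hp : WeylMultipliers.IsNonOverlappingPolynomials f p)
    (hnorm : ∀ n, eLpNorm (p n) 2 WeylMultipliers.unitMeasure = 1)
    (ω : ℕ → ℝ) (hpos : ∀ n, 0 < ω n) (hmono : Monotone ω)
    (hsum : Summable (fun n : ℕ => 1 / (((n : ℝ) + 1) * ω n))) :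
    WeylMultipliers.IsUCMultiplier ω p := by
  obtain ⟨ℱ, X, G, hX, hX2, hG, hpX⟩ :=
    WeylMultipliers.exists_martingaleDifference_of_isNonOverlappingPolynomials hf hp
      fun n => hnorm n ▸ ENNReal.one_lt_top
  have hsum' : Summable fun n : ℕ => (ω n)⁻¹ / (n + 1) := hsum.congr fun n => by
    rw [one_div, mul_inv, div_eq_mul_inv, mul_comm]
  have hinv0 : ∀ n, 0 ≤ (ω n)⁻¹ := fun n => (inv_pos.2 (hpos n)).le
  have hinv := WeylMultipliers.antitone_inv_of_monotone hpos hmono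
  have hω := WeylMultipliers.tendsto_atTop_of_summable_inv_comp hpos hmono
    (WeylMultipliers.summable_comp_two_pow hinv0 hinv hsum')
  have hon := hX.isOrthonormalSystem hX2 hG hpX hnorm
  refine ⟨hon, hpos, hmono, hω, fun a ha σ => ?_⟩
  have hone : ∀ n, ∫ x, (∑ j ∈ G n, X j x) ^ 2 ∂WeylMultipliers.unitMeasure = 1 := fun n => by
    simp only [sq]
    exact (integral_congr_ae ((hpX n).mul (hpX n))).symm.trans (hon.norm_eq_one n)
  filter_upwards [ae_all_iff.2 hpX, hX.ae_exists_tendsto_sum_mul_comp_perm hX2 hG hpos hmono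
    (WeylMultipliers.summable_two_pow_mul_comp_two_pow_two_pow hinv0 hinv hsum')
    (ha.congr fun n => by rw [hone n, mul_one]) σ] with x hpx hconv
  simpa only [hpx] using hconv

theorem corollary3
    (f : ℕ → ℝ → ℝ) (hf : WeylMultipliers.IsMartingaleDifference f)
    (p : ℕ → ℝ → ℝ) (hp : WeylMultipliers.IsNonOverlappingPolynomials f p)
    (hnorm : ∀ n, eLpNorm (p n) 2 WeylMultipliers.unitMeasure = 1)
    (ω : ℕ → ℝ) (hpos : ∀ n, 0 < ω n) (hmono : Monotone ω)
    (hlog : MonotoneOn (fun n : ℕ => ω n / Real.logb 2 ((n : ℝ) + 1)) (Set.Ici 1))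
    (hsum : Summable (fun n : ℕ => 1 / (((n : ℝ) + 1) * ω n))) :
    WeylMultipliers.IsUCMultiplier ω p :=
  corollary3_general f hf p hp hnorm ω hpos hmono hsum
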